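/- Let $\mathcal A$ be a von Neumann algebra on a Hilbert space $\mathcal H$ with a cyclic and separating unit vector $\Omega$, and let $\omega(x)=\langle x\Omega,\Omega\rangle$. Let $(\mathcal A_t)_{t\ge 0}$ be an increasing family of von Neumann subalgebras of $\mathcal A$ with $\mathcal A=\mathcal A_\infty=(\bigcup_{t\ge 0}\mathcal A_t)''$, and assume that for each $t\ge 0$ there is a normal conditional expectation of $\mathcal A$ onto $\mathcal A_t$ leaving $\omega$ invariant. Let $P_t$ be the orthogonal projection of $\mathcal H$ onto $\overline{\mathcal A_t\Omega}$, $t\in[0,\infty]$. Let $\tau=(q_t)_{t\in[0,\infty]}$ be a stopping time: an increasing family of projections with $q_t\in\mathcal A_t$, $q_0=0$, $q_\infty=\mathbf 1$. For $u\in(0,\infty]$ and a partition $\theta=\{0=t_0<t_1<\dots<t_n=u\}$ put $M_{\tau(\theta)}(u)=\sum_{i=1}^n(q_{t_i}-q_{t_{i-1}})P_{t_i}$, and let the time projection be $M_\tau(u)=\bigwedge_\theta M_{\tau(\theta)}(u)=\lim_\theta M_{\tau(\theta)}(u)$ (strong limit along refinement of partitions, which exists); write $M_\tau=M_\tau(\infty)$.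 Put $$\mathcal B_\tau(u)=\{x\in\mathcal A: xq_t=q_tx \text{ for all } t\le u\},\qquad \mathcal A_\tau(u)=\{x\in\mathcal A: xq_t=q_tx\in\mathcal A_t\text{ for all }t\le u\},$$ $\mathcal B_\tau=\mathcal B_\tau(\infty)$ and $\mathcal A_\tau=\mathcal A_\tau(\infty)$. A conditional expectation of a von Neumann algebra $\mathcal M$ onto a $*$-subalgebra $\mathcal N$ (whose unit may differ from that of $\mathcal M$) is a positive linear map $E:\mathcal M\to\mathcal N$ with $E(y)=y$ for $y\in\mathcal N$ and $E(axb)=aE(x)b$ for $a,b\in\mathcal N$, $x\in\mathcal M$. (1) There is a normal faithful conditional expectation $\mathbb E_\tau$ of $\mathcal B_\tau$ onto $\mathcal A_\tau$ such that $(\mathbb E_\tau x)\Omega=M_\tau(x\Omega)$ and $\omega(\mathbb E_\tau x)=\omega(x)$ for all $x\in\mathcal B_\tau$. (2) For every $u\in(0,\infty]$ there is a normal conditional expectation $\mathbb E_{\tau,u}$ of $\mathcal B_\tau(u)$ onto $q_u\mathcal A_\tau(u)q_u$ such that $(\mathbb E_{\tau,u}x)\Omega=M_\tau(u)(x\Omega)$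 and $\omega(\mathbb E_{\tau,u}x)=\omega(q_uxq_u)$ for all $x\in\mathcal B_\tau(u)$, and such that $x\ge 0$, $\mathbb E_{\tau,u}x=0$ imply $q_uxq_u=0$. In particular $\mathbb E_{\tau,u}$ is faithful and leaves $\omega$ invariant on $q_u\mathcal B_\tau(u)q_u$. -/

import Mathlib

open Filter Topology
open scoped ENNReal NNReal InnerProductSpace

namespace QuantumStopping

variable {H : Type*} [NormedAddCommGroup H] [InnerProductSpace ℂ H] [CompleteSpace H]

/-! ### Conditional expectations -/

/-- A von Neumann algebra regarded as a (not necessarily unital) star-subalgebra of `B(H)`. -/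
noncomputable def asAlg (M : VonNeumannAlgebra H) : NonUnitalStarSubalgebra ℂ (H →L[ℂ] H) :=
  M.toStarSubalgebra.toNonUnitalStarSubalgebra

/-- `E` is a conditional expectation from the von Neumann algebra `M` onto its star-subalgebra `N`:
a positive linear projection of `M` onto `N` which is an `N`-bimodule map. The unit of `N`, if it
has one, may be different from that of `M`. -/
structure IsCondExp (M : VonNeumannAlgebra H) (N : NonUnitalStarSubalgebra ℂ (H →L[ℂ] H))
    (E : M.toStarSubalgebra →ₗ[ℂ] N) : Prop where
  subset : ∀ y ∈ N, y ∈ M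
  fixes : ∀ x : M.toStarSubalgebra, (x : H →L[ℂ] H) ∈ N → (E x : H →L[ℂ] H) = x
  nonneg : ∀ x : M.toStarSubalgebra, 0 ≤ (x : H →L[ℂ] H) → 0 ≤ (E x : H →L[ℂ] H)
  bimodule : ∀ (a b : N) (x y : M.toStarSubalgebra),
    (y : H →L[ℂ] H) = (a : H →L[ℂ] H) * x * b →
    (E y : H →L[ℂ] H) = (a : H →L[ℂ] H) * E x * b

/-- Normality of a linear map: it preserves least upper bounds of bounded increasing nets
(nonempty upward directed sets) of self-adjoint elements. -/
def IsNormalMap (M : VonNeumannAlgebra H) (N : NonUnitalStarSubalgebra ℂ (H →L[ℂ] H))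
    (E : M.toStarSubalgebra →ₗ[ℂ] N) : Prop :=
  ∀ (D : Set M.toStarSubalgebra) (x : M.toStarSubalgebra),
    D.Nonempty → DirectedOn (· ≤ ·) D → (∀ d ∈ D, IsSelfAdjoint (d : H →L[ℂ] H)) →
    IsLUB D x → IsLUB (E '' D) (E x)

/-- Faithfulness of a positive linear map. -/
def IsFaithfulMap (M : VonNeumannAlgebra H) (N : NonUnitalStarSubalgebra ℂ (H →L[ℂ] H))
    (E : M.toStarSubalgebra →ₗ[ℂ] N) : Prop :=
  ∀ x : M.toStarSubalgebra, 0 ≤ (x : H →L[ℂ] H) → E x = 0 → x = 0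

/-- The vector functional `x ↦ ⟨x Ω, Ω⟩` (Mathlib's inner product is linear in the second slot). -/
noncomputable def vecState (Ω : H) (x : H →L[ℂ] H) : ℂ := ⟪Ω, x Ω⟫_ℂ

/-- `Ω` is cyclic for `A`: the subspace `A Ω` is dense. -/
def IsCyclicVector (A : VonNeumannAlgebra H) (Ω : H) : Prop :=
  Dense {ξ : H | ∃ x ∈ A, x Ω = ξ}

/-- `Ω` is separating for `A`: an element of `A` that annihilates `Ω` is zero. -/
def IsSeparatingVector (A : VonNeumannAlgebra H) (Ω : H) : Prop :=
  ∀ x ∈ A, x Ω = 0 → x = 0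

/-! ### Filtrations and stopping times -/

/-- A filtration, indexed by `[0, ∞]`: an increasing family of von Neumann algebras such that the
algebra at time `∞` is generated by those at finite times. The ambient algebra is the one at time
`∞`. -/
structure VNFiltration (H : Type*) [NormedAddCommGroup H] [InnerProductSpace ℂ H]
    [CompleteSpace H] where
  alg : ℝ≥0∞ → VonNeumannAlgebra H
  mono : Monotone alg
  generates : (alg ⊤ : Set (H →L[ℂ] H)) =
    Set.centralizer (Set.centralizer (⋃ t : ℝ≥0, (alg t : Set (H →L[ℂ] H))))

/-- A stopping time: an increasing family `(q_t)`, `t ∈ [0, ∞]`, of projections adapted to the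
filtration, with `q_0 = 0` and `q_∞ = 1`. -/
structure StoppingTime (F : VNFiltration H) where
  q : ℝ≥0∞ → H →L[ℂ] H
  proj : ∀ t, IsStarProjection (q t)
  adapted : ∀ t, q t ∈ F.alg t
  mono : Monotone q
  zero : q 0 = 0
  top : q ⊤ = 1

/-- The subspace `N Ω`. -/
noncomputable def orbit (N : VonNeumannAlgebra H) (Ω : H) : Submodule ℂ H :=
  N.toStarSubalgebra.toSubalgebra.toSubmodule.map (ContinuousLinearMap.apply ℂ H Ω).toLinearMap

/-- The orthogonal projection `P_t` of `H` onto the closure of `A_t Ω`. -/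
noncomputable def VNFiltration.P (F : VNFiltration H) (Ω : H) (t : ℝ≥0∞) : H →L[ℂ] H :=
  (orbit (F.alg t) Ω).topologicalClosure.starProjection

/-- There are normal conditional expectations of the ambient algebra onto the algebras at finite
times that leave the vector state given by `Ω` invariant. -/
def VNFiltration.HasCondExps (F : VNFiltration H) (Ω : H) : Prop :=
  ∀ t : ℝ≥0, ∃ E : (F.alg ⊤).toStarSubalgebra →ₗ[ℂ] asAlg (F.alg t),
    IsCondExp (F.alg ⊤) (asAlg (F.alg t)) E ∧ IsNormalMap (F.alg ⊤) (asAlg (F.alg t)) E ∧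
    ∀ x, vecState Ω (E x) = vecState Ω x

/-- The projection `P_t` implements every conditional expectation onto `A_t` which leaves the
vector state invariant: `P_t (x Ω) = (E x) Ω`. -/
theorem VNFiltration.P_apply_of_condExp (F : VNFiltration H) (Ω : H) (t : ℝ≥0∞)
    (E : (F.alg ⊤).toStarSubalgebra →ₗ[ℂ] asAlg (F.alg t))
    (hE : IsCondExp (F.alg ⊤) (asAlg (F.alg t)) E)
    (hΩ : ∀ x, vecState Ω (E x) = vecState Ω x) (x : (F.alg ⊤).toStarSubalgebra) :
    F.P Ω t ((x : H →L[ℂ] H) Ω) = (E x : H →L[ℂ] H) Ω := by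
  apply Submodule.eq_starProjection_of_mem_of_inner_eq_zero
  · exact Submodule.le_topologicalClosure _ ⟨E x, (E x).2, rfl⟩
  · intro w hw
    have hcl : IsClosed {w : H | ⟪(x : H →L[ℂ] H) Ω - (E x : H →L[ℂ] H) Ω, w⟫_ℂ = 0} :=
      isClosed_eq (by fun_prop) continuous_const
    have hsub : ((orbit (F.alg t) Ω : Submodule ℂ H) : Set H) ⊆
        {w : H | ⟪(x : H →L[ℂ] H) Ω - (E x : H →L[ℂ] H) Ω, w⟫_ℂ = 0} := by
      rintro _ ⟨a, ha, rfl⟩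
      have ha' : star a ∈ asAlg (F.alg t) := star_mem (s := F.alg t) (r := a) ha
      have h1 : (1 : H →L[ℂ] H) ∈ asAlg (F.alg t) := one_mem (F.alg t).toStarSubalgebra
      have hM : star a * (x : H →L[ℂ] H) ∈ (F.alg ⊤).toStarSubalgebra :=
        mul_mem (hE.subset _ ha') x.2
      have hb := hE.bimodule ⟨star a, ha'⟩ ⟨1, h1⟩ x ⟨_, hM⟩ (by simp)
      have hv := hΩ ⟨_, hM⟩
      rw [hb] at hv
      simp only [vecState, mul_one, mul_apply_eq_comp,
        ContinuousLinearMap.star_eq_adjoint, ContinuousLinearMap.adjoint_inner_right] at hv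
      show ⟪(x : H →L[ℂ] H) Ω - (E x : H →L[ℂ] H) Ω, a Ω⟫_ℂ = 0
      rw [← inner_conj_symm, inner_sub_right, ← hv, sub_self, map_zero]
    exact closure_minimal hsub hcl hw

/-! ### The time projection -/

/-- A partition `0 = t_0 < t_1 < ... < t_n = u` of the interval `[0, u]`. -/
structure TimePartition (u : ℝ≥0∞) where
  n : ℕ
  t : Fin (n + 1) → ℝ≥0∞
  strictMono : StrictMono t
  first : t 0 = 0
  last : t (Fin.last n) = u

/-- Partitions are ordered by refinement. -/
instance (u : ℝ≥0∞) : Preorder (TimePartition u) :=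
  Preorder.lift fun θ => Set.range θ.t

/-- Any two partitions have a common refinement. -/
instance (u : ℝ≥0∞) : IsDirectedOrder (TimePartition u) where
  directed θ η := by
    classical
    set s : Finset ℝ≥0∞ := Finset.univ.image θ.t ∪ Finset.univ.image η.t with hs
    have h0 : (0 : ℝ≥0∞) ∈ s := by
      rw [hs, ← θ.first]; simp
    have hu : u ∈ s := by
      simp only [hs, Finset.mem_union, Finset.mem_image, Finset.mem_univ, true_and]
      exact Or.inl ⟨_, θ.last⟩
    have hle : ∀ x ∈ s, x ≤ u := by
      intro x hx
      simp only [hs, Finset.mem_union, Finset.mem_image, Finset.mem_univ, true_and] at hx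
      rcases hx with ⟨i, rfl⟩ | ⟨i, rfl⟩
      · exact (θ.strictMono.monotone (Fin.le_last i)).trans θ.last.le
      · exact (η.strictMono.monotone (Fin.le_last i)).trans η.last.le
    have hc : s.card = (s.card - 1) + 1 :=
      (Nat.succ_pred_eq_of_pos (Finset.card_pos.2 ⟨0, h0⟩)).symm
    set f := s.orderEmbOfFin hc
    have hr : Set.range f = s := Finset.range_orderEmbOfFin s hc
    have hf0 : f 0 = 0 := by
      obtain ⟨i, hi⟩ : (0 : ℝ≥0∞) ∈ Set.range f := by rw [hr]; exact h0
      exact le_antisymm ((f.monotone (Fin.zero_le i)).trans hi.le) zero_le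
    have hfl : f (Fin.last _) = u := by
      obtain ⟨i, hi⟩ : u ∈ Set.range f := by rw [hr]; exact hu
      refine le_antisymm (hle _ ?_) (hi.symm.le.trans (f.monotone (Fin.le_last i)))
      have : f (Fin.last _) ∈ Set.range f := ⟨_, rfl⟩
      rw [hr] at this
      exact this
    refine ⟨⟨_, f, f.strictMono, hf0, hfl⟩, ?_, ?_⟩
    · show Set.range θ.t ⊆ Set.range f
      rw [hr, hs]; rintro _ ⟨i, rfl⟩; simp
    · show Set.range η.t ⊆ Set.range f
      rw [hr, hs]; rintro _ ⟨i, rfl⟩; simp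

namespace StoppingTime

variable {F : VNFiltration H}

/-- The operator `M_{τ(θ)}(u) = ∑ᵢ (q_{tᵢ} - q_{tᵢ₋₁}) P_{tᵢ}` of a partition `θ` of `[0, u]`. -/
noncomputable def partSum (τ : StoppingTime F) (Ω : H) {u : ℝ≥0∞} (θ : TimePartition u) :
    H →L[ℂ] H :=
  ∑ i : Fin θ.n, (τ.q (θ.t i.succ) - τ.q (θ.t i.castSucc)) * F.P Ω (θ.t i.succ)

/-- The time projection `M_τ(u)`: the infimum of the projections `M_{τ(θ)}(u)` over all partitions
`θ` of `[0, u]`, i.e. the orthogonal projection onto the intersection of their ranges. -/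
noncomputable def timeProj (τ : StoppingTime F) (Ω : H) (u : ℝ≥0∞) : H →L[ℂ] H :=
  (⨅ θ : TimePartition u, (τ.partSum Ω θ).toLinearMap.range).topologicalClosure.starProjection

/-- `M_τ(u)` is the strong limit of `M_{τ(θ)}(u)` as the partition `θ` of `[0, u]` refines. -/
def IsStrongLimit (τ : StoppingTime F) (Ω : H) (u : ℝ≥0∞) : Prop :=
  ∀ ξ : H, Tendsto (fun θ : TimePartition u => τ.partSum Ω θ ξ) atTop (𝓝 (τ.timeProj Ω u ξ))

/-! ### The algebras attached to a stopping time -/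

/-- The relative commutant `B_τ(u)` of `{q_t : t ≤ u}` in the ambient algebra. -/
noncomputable def B (τ : StoppingTime F) (u : ℝ≥0∞) : VonNeumannAlgebra H where
  carrier := {x | x ∈ F.alg ⊤ ∧ ∀ t ≤ u, x * τ.q t = τ.q t * x}
  mul_mem' := by
    rintro x y ⟨hx, hx'⟩ ⟨hy, hy'⟩
    exact ⟨mul_mem hx hy, fun t ht => by rw [mul_assoc, hy' t ht, ← mul_assoc, hx' t ht, mul_assoc]⟩
  add_mem' := by
    rintro x y ⟨hx, hx'⟩ ⟨hy, hy'⟩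
    exact ⟨add_mem hx hy, fun t ht => by rw [add_mul, mul_add, hx' t ht, hy' t ht]⟩
  algebraMap_mem' c :=
    ⟨(F.alg ⊤).toStarSubalgebra.algebraMap_mem c, fun t _ => Algebra.commutes c (τ.q t)⟩
  star_mem' := by
    rintro x ⟨hx, hx'⟩
    refine ⟨star_mem hx, fun t ht => ?_⟩
    have h := congrArg star (hx' t ht)
    rw [star_mul, star_mul, (τ.proj t).isSelfAdjoint.star_eq] at h
    exact h.symm
  centralizer_centralizer' := by
    have key : {x | x ∈ F.alg ⊤ ∧ ∀ t ≤ u, x * τ.q t = τ.q t * x} =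
        Set.centralizer (Set.centralizer (F.alg ⊤ : Set (H →L[ℂ] H)) ∪ {y | ∃ t ≤ u, y = τ.q t}) := by
      ext x
      rw [Set.centralizer_union, VonNeumannAlgebra.centralizer_centralizer]
      refine and_congr Iff.rfl ?_
      simp only [Set.mem_centralizer_iff, Set.mem_ofPred_eq]
      constructor
      · rintro h _ ⟨t, ht, rfl⟩
        exact (h t ht).symm
      · intro h t ht
        exact (h _ ⟨t, ht, rfl⟩).symm
    show Set.centralizer (Set.centralizer {x | x ∈ F.alg ⊤ ∧ ∀ t ≤ u, x * τ.q t = τ.q t * x}) = _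
    rw [key, Set.centralizer_centralizer_centralizer]

/-- The algebra `A_τ(u)` of all `x` in the ambient algebra with `x q_t = q_t x ∈ A_t` for every
`t ≤ u`. -/
noncomputable def A (τ : StoppingTime F) (u : ℝ≥0∞) : VonNeumannAlgebra H where
  carrier := {x | x ∈ F.alg ⊤ ∧ ∀ t ≤ u, x * τ.q t = τ.q t * x ∧ τ.q t * x ∈ F.alg t}
  mul_mem' := by
    rintro x y ⟨hx, hx'⟩ ⟨hy, hy'⟩
    refine ⟨mul_mem hx hy, fun t ht => ⟨?_, ?_⟩⟩
    · rw [mul_assoc, (hy' t ht).1, ← mul_assoc, (hx' t ht).1, mul_assoc]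
    · have h : τ.q t * (x * y) = (τ.q t * x) * (τ.q t * y) := by
        rw [← (hx' t ht).1, mul_assoc x, ← mul_assoc (τ.q t) (τ.q t),
          (τ.proj t).isIdempotentElem.eq, ← mul_assoc x, (hx' t ht).1, mul_assoc]
      rw [h]
      exact mul_mem (hx' t ht).2 (hy' t ht).2
  add_mem' := by
    rintro x y ⟨hx, hx'⟩ ⟨hy, hy'⟩
    refine ⟨add_mem hx hy, fun t ht => ⟨?_, ?_⟩⟩
    · rw [add_mul, mul_add, (hx' t ht).1, (hy' t ht).1]
    · rw [mul_add]
      exact add_mem (hx' t ht).2 (hy' t ht).2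
  algebraMap_mem' c :=
    ⟨(F.alg ⊤).toStarSubalgebra.algebraMap_mem c, fun t _ => ⟨Algebra.commutes c (τ.q t),
      mul_mem (τ.adapted t) ((F.alg t).toStarSubalgebra.algebraMap_mem c)⟩⟩
  star_mem' := by
    rintro x ⟨hx, hx'⟩
    refine ⟨star_mem hx, fun t ht => ⟨?_, ?_⟩⟩
    · have h := congrArg star (hx' t ht).1
      rw [star_mul, star_mul, (τ.proj t).isSelfAdjoint.star_eq] at h
      exact h.symm
    · have h := (hx' t ht).2
      rw [← (hx' t ht).1] at h
      have h' := star_mem h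
      rwa [star_mul, (τ.proj t).isSelfAdjoint.star_eq] at h'
  centralizer_centralizer' := by
    have key : {x | x ∈ F.alg ⊤ ∧ ∀ t ≤ u, x * τ.q t = τ.q t * x ∧ τ.q t * x ∈ F.alg t} =
        Set.centralizer (Set.centralizer (F.alg ⊤ : Set (H →L[ℂ] H)) ∪
          {y | ∃ t ≤ u, ∃ z ∈ Set.centralizer (F.alg t : Set (H →L[ℂ] H)), y = z * τ.q t}) := by
      ext x
      rw [Set.centralizer_union, VonNeumannAlgebra.centralizer_centralizer]
      refine and_congr Iff.rfl ?_
      simp only [Set.mem_centralizer_iff (S := {y | ∃ t ≤ u, ∃ z ∈ _, y = z * τ.q t}),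
        Set.mem_ofPred_eq]
      constructor
      · rintro h _ ⟨t, ht, z, hz, rfl⟩
        rw [mul_assoc, ← hz _ (h t ht).2, ← (h t ht).1, mul_assoc, hz _ (τ.adapted t)]
      · intro h t ht
        have h1 : x * τ.q t = τ.q t * x := by
          have := h _ ⟨t, ht, 1, Set.one_mem_centralizer, rfl⟩
          rw [one_mul] at this
          exact this.symm
        refine ⟨h1, ?_⟩
        rw [← SetLike.mem_coe, ← VonNeumannAlgebra.centralizer_centralizer (F.alg t)]
        intro z hz
        rw [← mul_assoc, h _ ⟨t, ht, z, hz, rfl⟩, ← hz _ (τ.adapted t), ← mul_assoc, h1]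
    show Set.centralizer (Set.centralizer
      {x | x ∈ F.alg ⊤ ∧ ∀ t ≤ u, x * τ.q t = τ.q t * x ∧ τ.q t * x ∈ F.alg t}) = _
    rw [key, Set.centralizer_centralizer_centralizer]

theorem q_mem_A (τ : StoppingTime F) (u : ℝ≥0∞) : τ.q u ∈ τ.A u := by
  have hle : ∀ t ≤ u, τ.q t * τ.q u = τ.q t ∧ τ.q u * τ.q t = τ.q t := fun t ht => by
    have h1 := ((τ.proj t).le_iff_mul_eq_left (τ.proj u)).1 (τ.mono ht)
    exact ⟨h1, ((τ.proj t).le_iff_mul_eq_right (τ.proj u)).1 (τ.mono ht)⟩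
  refine ⟨F.mono le_top (τ.adapted u), fun t ht => ⟨?_, ?_⟩⟩
  · rw [(hle t ht).1, (hle t ht).2]
  · rw [(hle t ht).1]
    exact τ.adapted t

/-- The reduced algebra `q_u A_τ(u) q_u`. -/
noncomputable def reducedA (τ : StoppingTime F) (u : ℝ≥0∞) :
    NonUnitalStarSubalgebra ℂ (H →L[ℂ] H) where
  carrier := {y | ∃ x ∈ τ.A u, y = τ.q u * x * τ.q u}
  mul_mem' := by
    rintro _ _ ⟨x, hx, rfl⟩ ⟨y, hy, rfl⟩
    refine ⟨x * τ.q u * τ.q u * y, mul_mem (mul_mem (mul_mem hx (τ.q_mem_A u)) (τ.q_mem_A u)) hy, ?_⟩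
    simp only [mul_assoc]
  add_mem' := by
    rintro _ _ ⟨x, hx, rfl⟩ ⟨y, hy, rfl⟩
    exact ⟨x + y, add_mem hx hy, by rw [mul_add, add_mul]⟩
  zero_mem' := ⟨0, zero_mem _, by simp⟩
  smul_mem' := by
    rintro c _ ⟨x, hx, rfl⟩
    exact ⟨c • x, (τ.A u).toStarSubalgebra.smul_mem hx c, by simp⟩
  star_mem' := by
    rintro _ ⟨x, hx, rfl⟩
    exact ⟨star x, star_mem hx,
      by simp only [star_mul, (τ.proj u).isSelfAdjoint.star_eq, mul_assoc]⟩

end StoppingTime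

end QuantumStopping

open QuantumStopping

/-! For a partition θ of [0, u] put E_θ(x) = ∑ Δᵢ E_{tᵢ}(x), where Δᵢ = q_{tᵢ} - q_{tᵢ₋₁}. An x in
B_τ(u) commutes with Δᵢ ∈ A_{tᵢ}, hence so does E_{tᵢ}(x), and each term equals Δᵢ E_{tᵢ}(x) Δᵢ.
Thus E_θ is positive with E_θ(1) = q_u, so the operators E_θ(x) are bounded uniformly in θ
(`exists_norm_partExp_le`). Since P_t implements E_t, E_θ(x)Ω = M_{τ(θ)}(u)(xΩ)
(`partExp_apply_vec`).

The range of M_{τ(θ)}(u) is cut out by one condition per point of θ (`mem_range_partSum`), so these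
projections decrease under refinement and converge strongly to M_τ(u). For a in the commutant of A,
E_θ(x)aΩ = a M_{τ(θ)}(u)(xΩ) converges too. Such vectors are dense because Ω is separating, and
boundedness extends the convergence to all of H (`exists_limitExp`).

The limit inherits positivity, the bimodule property and the fixed points. Adaptedness at t holds
for every θ containing t, and von Neumann algebras are strongly closed, so the limit lies in A_τ(u).
From M_τ(u)Ω = q_uΩ comes the formula for the state, and with it faithfulness. Normality holds
because a least upper bound is a strong limit and E(x)aΩ depends continuously on xΩ. -/

namespace QuantumStopping

variable {H : Type*} [NormedAddCommGroup H] [InnerProductSpace ℂ H] [CompleteSpace H]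

/-! ### Strong limits of operators -/

/-- An eventually bounded net of operators that converges pointwise on a dense set converges
strongly to a bounded operator. -/
theorem exists_strongLimit_of_dense {ι : Type*} {l : Filter ι} [l.NeBot] (T : ι → H →L[ℂ] H)
    {C : ℝ} (hC : ∀ᶠ i in l, ‖T i‖ ≤ C) {S : Set H} (hS : Dense S)
    (h : ∀ ξ ∈ S, ∃ η, Tendsto (fun i => T i ξ) l (𝓝 η)) :
    ∃ T₀ : H →L[ℂ] H, ∀ ξ, Tendsto (fun i => T i ξ) l (𝓝 (T₀ ξ)) := by
  have hC0 : 0 ≤ C := by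
    obtain ⟨i, hi⟩ := hC.exists
    exact (norm_nonneg _).trans hi
  have key : ∀ ξ, ∃ η, Tendsto (fun i => T i ξ) l (𝓝 η) := by
    intro ξ
    rw [← cauchy_map_iff_exists_tendsto, Metric.cauchy_iff]
    refine ⟨inferInstance, fun ε hε => ?_⟩
    -- Replacing ξ by ζ costs at most ε/4; `C + 1` guards against division by zero.
    obtain ⟨ζ, hζS, hζ⟩ := hS.exists_dist_lt ξ (ε := ε / (4 * (C + 1))) (by positivity)
    obtain ⟨η, hη⟩ := h ζ hζS
    refine ⟨Metric.ball η (ε / 2), ?_, ?_⟩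
    · rw [mem_map]
      filter_upwards [hC, hη (Metric.ball_mem_nhds η (ε := ε / 4) (by positivity))] with i hi hi'
      rw [Set.mem_preimage, Metric.mem_ball] at hi' ⊢
      have h1 : dist (T i ξ) (T i ζ) ≤ C * dist ξ ζ := by
        rw [dist_eq_norm, dist_eq_norm, ← map_sub]
        exact (T i).le_of_opNorm_le hi _
      have h2 : C * dist ξ ζ ≤ ε / 4 := by
        calc C * dist ξ ζ ≤ (C + 1) * (ε / (4 * (C + 1))) := by gcongr; linarith
          _ = ε / 4 := by field_simp
      linarith [dist_triangle (T i ξ) (T i ζ) η]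
    · intro a ha b hb
      rw [Metric.mem_ball] at ha hb
      linarith [dist_triangle_right a b η]
  choose f hf using key
  have hb : ∀ ξ, ‖f ξ‖ ≤ C * ‖ξ‖ := fun ξ =>
    le_of_tendsto (hf ξ).norm (hC.mono fun i hi => (T i).le_of_opNorm_le hi ξ)
  refine ⟨LinearMap.mkContinuous
    { toFun := f
      map_add' := fun ξ η => tendsto_nhds_unique (hf (ξ + η)) (by simpa using (hf ξ).add (hf η))
      map_smul' := fun c ξ => tendsto_nhds_unique (hf (c • ξ)) (by simpa using (hf ξ).const_smul c) }
    C hb, fun ξ => hf ξ⟩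

/-- A positive operator `T` satisfies `‖T ξ‖² ≤ ‖T‖ ⟨ξ, T ξ⟩`. -/
theorem norm_apply_sq_le_of_nonneg {T : H →L[ℂ] H} (hT : 0 ≤ T) (ξ : H) :
    ‖T ξ‖ ^ 2 ≤ ‖T‖ * (⟪ξ, T ξ⟫_ℂ).re := by
  obtain ⟨S, rfl⟩ := CStarAlgebra.nonneg_iff_eq_star_mul_self.1 hT
  have h1 : (⟪ξ, (star S * S) ξ⟫_ℂ).re = ‖S ξ‖ ^ 2 := by
    rw [ContinuousLinearMap.star_eq_adjoint, mul_apply_eq_comp,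
      ContinuousLinearMap.adjoint_inner_right]
    exact (norm_sq_eq_re_inner (𝕜 := ℂ) (S ξ)).symm
  rw [h1, CStarRing.norm_star_mul_self, mul_apply_eq_comp]
  calc ‖star S (S ξ)‖ ^ 2 ≤ (‖star S‖ * ‖S ξ‖) ^ 2 := by
        gcongr; exact ContinuousLinearMap.le_opNorm _ _
    _ = ‖S‖ * ‖S‖ * ‖S ξ‖ ^ 2 := by rw [norm_star]; ring

theorem apply_eq_zero_of_nonneg_of_inner_eq_zero {T : H →L[ℂ] H} (hT : 0 ≤ T) {ξ : H}
    (h : ⟪ξ, T ξ⟫_ℂ = 0) : T ξ = 0 := by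
  have := norm_apply_sq_le_of_nonneg hT ξ
  rw [h, Complex.zero_re, mul_zero] at this
  exact norm_eq_zero.1 (pow_eq_zero_iff two_ne_zero |>.1 (le_antisymm this (sq_nonneg _)))

theorem le_iff_forall_re_inner {S T : H →L[ℂ] H} (hS : IsSelfAdjoint S) (hT : IsSelfAdjoint T) :
    S ≤ T ↔ ∀ ξ, (⟪ξ, S ξ⟫_ℂ).re ≤ (⟪ξ, T ξ⟫_ℂ).re := by
  rw [ContinuousLinearMap.le_def, ContinuousLinearMap.isPositive_def',
    and_iff_right (hT.sub hS)]
  refine forall_congr' fun ξ => ?_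
  rw [ContinuousLinearMap.reApplyInnerSelf_apply, inner_re_symm]
  simp [inner_sub_right]

theorem re_inner_le_of_le {S T : H →L[ℂ] H} (h : S ≤ T) (ξ : H) :
    (⟪ξ, S ξ⟫_ℂ).re ≤ (⟪ξ, T ξ⟫_ℂ).re := by
  have := ContinuousLinearMap.IsPositive.re_inner_nonneg_right ((ContinuousLinearMap.le_def _ _).1 h) ξ
  simpa [inner_sub_right] using this

/-- A pointwise limit of self-adjoint operators is self-adjoint. -/
theorem isSelfAdjoint_of_tendsto {ι : Type*} {l : Filter ι} [l.NeBot] {T : ι → H →L[ℂ] H}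
    {T₀ : H →L[ℂ] H} (hT : ∀ᶠ i in l, IsSelfAdjoint (T i))
    (h : ∀ ξ, Tendsto (fun i => T i ξ) l (𝓝 (T₀ ξ))) : IsSelfAdjoint T₀ := by
  rw [ContinuousLinearMap.isSelfAdjoint_iff_isSymmetric]
  intro ξ η
  refine tendsto_nhds_unique_of_eventuallyEq ((h ξ).inner tendsto_const_nhds)
    (tendsto_const_nhds.inner (h η)) (hT.mono fun i hi => ?_)
  exact (ContinuousLinearMap.isSelfAdjoint_iff_isSymmetric.1 hi) ξ η

/-- A pointwise limit of positive operators is positive. -/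
theorem nonneg_of_tendsto {ι : Type*} {l : Filter ι} [l.NeBot] {T : ι → H →L[ℂ] H}
    {T₀ : H →L[ℂ] H} (hT : ∀ᶠ i in l, 0 ≤ T i)
    (h : ∀ ξ, Tendsto (fun i => T i ξ) l (𝓝 (T₀ ξ))) : 0 ≤ T₀ := by
  have hsa := isSelfAdjoint_of_tendsto (hT.mono fun i hi => IsSelfAdjoint.of_nonneg hi) h
  rw [le_iff_forall_re_inner (.zero _) hsa]
  intro ξ
  refine ge_of_tendsto ((Complex.continuous_re.tendsto _).comp
    (tendsto_const_nhds.inner (h ξ))) (hT.mono fun i hi => ?_)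
  exact re_inner_le_of_le hi ξ

/-- The quadratic form is continuous. This lets normality be tested on the vectors aΩ with a in the
commutant. -/
theorem nonneg_of_dense {T : H →L[ℂ] H} (hT : IsSelfAdjoint T) {S : Set H} (hS : Dense S)
    (h : ∀ ξ ∈ S, 0 ≤ (⟪ξ, T ξ⟫_ℂ).re) : 0 ≤ T := by
  rw [le_iff_forall_re_inner (.zero _) hT]
  intro ξ
  have hcl : IsClosed {ξ : H | 0 ≤ (⟪ξ, T ξ⟫_ℂ).re} :=
    isClosed_le continuous_const (by fun_prop)
  have hξ : 0 ≤ (⟪ξ, T ξ⟫_ℂ).re := closure_minimal h hcl (hS ξ)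
  simpa using hξ

/-- A von Neumann algebra is closed under pointwise limits. -/
theorem mem_of_tendsto_apply {ι : Type*} {l : Filter ι} [l.NeBot] (M : VonNeumannAlgebra H)
    {T : ι → H →L[ℂ] H} {T₀ : H →L[ℂ] H} (hT : ∀ᶠ i in l, T i ∈ M)
    (h : ∀ ξ, Tendsto (fun i => T i ξ) l (𝓝 (T₀ ξ))) : T₀ ∈ M := by
  rw [← M.commutant_commutant, VonNeumannAlgebra.mem_commutant_iff]
  intro g hg
  ext ξ
  refine tendsto_nhds_unique_of_eventuallyEq ((g.continuous.tendsto _).comp (h ξ)) (h (g ξ))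
    (hT.mono fun i hi => ?_)
  exact (congrArg (· ξ) (VonNeumannAlgebra.mem_commutant_iff.1 hg _ hi)).symm

/-- **Vigier's theorem**: a bounded increasing net of self-adjoint operators converges strongly. -/
theorem exists_strongLimit_of_monotone {ι : Type*} [Preorder ι] [IsDirectedOrder ι] [Nonempty ι]
    {T : ι → H →L[ℂ] H} (hT : Monotone T) {b : H →L[ℂ] H} (hb : ∀ i, T i ≤ b) :
    ∃ T₀ : H →L[ℂ] H, ∀ ξ, Tendsto (fun i => T i ξ) atTop (𝓝 (T₀ ξ)) := by
  obtain ⟨i₀⟩ := ‹Nonempty ι›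
  have : Nonempty ι := ⟨i₀⟩
  -- An increasing net need not be bounded below, so norm bounds are available only beyond a fixed
  -- index.
  have hle : ∀ {i j}, i₀ ≤ i → i ≤ j → ‖T j - T i‖ ≤ ‖b - T i₀‖ := fun hi hij =>
    CStarAlgebra.norm_le_norm_of_nonneg_of_le (sub_nonneg.2 (hT hij)) (sub_le_sub (hb _) (hT hi))
  refine exists_strongLimit_of_dense T (C := ‖b - T i₀‖ + ‖T i₀‖) ?_ dense_univ fun ξ _ => ?_
  · filter_upwards [eventually_ge_atTop i₀] with i hi
    calc ‖T i‖ = ‖(T i - T i₀) + T i₀‖ := by rw [sub_add_cancel]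
      _ ≤ _ := (norm_add_le _ _).trans (by gcongr; exact hle le_rfl hi)
  · set φ : ι → ℝ := fun i => (⟪ξ, T i ξ⟫_ℂ).re
    have hφ : Monotone φ := fun i j hij => re_inner_le_of_le (hT hij) ξ
    have hφb : BddAbove (Set.range φ) :=
      ⟨(⟪ξ, b ξ⟫_ℂ).re, by rintro _ ⟨i, rfl⟩; exact re_inner_le_of_le (hb i) ξ⟩
    have hlim := tendsto_atTop_ciSup hφ hφb
    set s := ⨆ i, φ i
    set K := ‖b - T i₀‖ + 1
    have hK : 0 < K := by positivity
    rw [← cauchy_map_iff_exists_tendsto, Metric.cauchy_iff]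
    refine ⟨inferInstance, fun ε hε => ?_⟩
    -- Chosen so that ‖(T j - T i₁)ξ‖² ≤ K · (ε/3)²/K, by the inequality ‖Sξ‖² ≤ ‖S‖⟨ξ, Sξ⟩ for S ≥
    -- 0.
    have hδ : 0 < (ε / 3) ^ 2 / K := by positivity
    obtain ⟨i₁, hi₁, h1⟩ := ((eventually_ge_atTop i₀).and
      (hlim.eventually (lt_mem_nhds (sub_lt_self s hδ)))).exists
    refine ⟨Metric.closedBall (T i₁ ξ) (ε / 3), ?_, fun x hx y hy => ?_⟩
    · rw [mem_map]
      filter_upwards [eventually_ge_atTop i₁] with j hj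
      rw [Set.mem_preimage, Metric.mem_closedBall, dist_eq_norm]
      refine le_of_sq_le_sq ?_ (by positivity)
      calc ‖T j ξ - T i₁ ξ‖ ^ 2 ≤ ‖T j - T i₁‖ * (⟪ξ, (T j - T i₁) ξ⟫_ℂ).re :=
            norm_apply_sq_le_of_nonneg (sub_nonneg.2 (hT hj)) ξ
        _ ≤ K * ((ε / 3) ^ 2 / K) := by
            have h2 : (⟪ξ, (T j - T i₁) ξ⟫_ℂ).re = φ j - φ i₁ := by
              simp [φ]
            have h3 : φ j ≤ s := le_ciSup hφb j
            have h4 : φ i₁ ≤ φ j := hφ hj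
            rw [h2]
            have := hle hi₁ hj
            gcongr
            · exact this.trans (lt_add_one _).le
            · linarith
        _ = (ε / 3) ^ 2 := by field_simp
    · rw [Metric.mem_closedBall] at hx hy
      linarith [dist_triangle_right x y (T i₁ ξ)]

/-- The projection p onto the closure of M'Ω reduces M', so it lies in M'' = M. As 1 - p annihilates
Ω, separation forces p = 1. -/
theorem IsSeparatingVector.dense_commutant {M : VonNeumannAlgebra H} {Ω : H}
    (h : IsSeparatingVector M Ω) : IsCyclicVector M.commutant Ω := by
  have hp : (orbit M.commutant Ω).topologicalClosure.starProjection ∈ M := by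
    rw [VonNeumannAlgebra.IsStarProjection.mem_iff isStarProjection_starProjection]
    intro y hy
    rw [Submodule.range_starProjection, Module.End.mem_invtSubmodule]
    refine Submodule.topologicalClosure_minimal _ ?_
      ((Submodule.isClosed_topologicalClosure _).preimage y.continuous)
    rintro _ ⟨a, ha, rfl⟩
    exact Submodule.le_topologicalClosure _ ⟨y * a, M.commutant.mul_mem' hy ha, rfl⟩
  have h0 := h _ (sub_mem (one_mem M) hp) (by
    have : Ω ∈ (orbit M.commutant Ω).topologicalClosure :=
      Submodule.le_topologicalClosure _ ⟨1, one_mem M.commutant, rfl⟩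
    simp [Submodule.starProjection_eq_self_iff.2 this])
  have hset : {ξ : H | ∃ x ∈ M.commutant, x Ω = ξ} = (orbit M.commutant Ω : Set H) := rfl
  rw [IsCyclicVector, hset, Submodule.dense_iff_topologicalClosure_eq_top]
  rw [sub_eq_zero] at h0
  rw [← Submodule.range_starProjection (orbit M.commutant Ω).topologicalClosure, ← h0]
  exact LinearMap.range_id

/-- The least upper bound, in a von Neumann algebra, of a bounded increasing net of self-adjoint
elements is its strong limit. -/
theorem tendsto_apply_of_isLUB {M : VonNeumannAlgebra H} {D : Set M.toStarSubalgebra}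
    {x : M.toStarSubalgebra} (hne : D.Nonempty) (hdir : DirectedOn (· ≤ ·) D)
    (hx : IsLUB D x) (ξ : H) :
    Tendsto (fun d : D => ((d : M.toStarSubalgebra) : H →L[ℂ] H) ξ) atTop
      (𝓝 ((x : H →L[ℂ] H) ξ)) := by
  have : Nonempty D := hne.to_subtype
  have : IsDirectedOrder D := ⟨fun a b => by
    obtain ⟨c, hc, hac, hbc⟩ := hdir a a.2 b b.2
    exact ⟨⟨c, hc⟩, hac, hbc⟩⟩
  obtain ⟨T₀, hT₀⟩ := exists_strongLimit_of_monotone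
    (T := fun d : D => ((d : M.toStarSubalgebra) : H →L[ℂ] H)) (fun _ _ h => h)
    (b := x) (fun d => hx.1 d.2)
  have hmem : T₀ ∈ M := mem_of_tendsto_apply M (Eventually.of_forall fun d : D => d.1.2) hT₀
  have hub : ∀ d ∈ D, (d : H →L[ℂ] H) ≤ T₀ := by
    intro d hd
    rw [← sub_nonneg]
    refine nonneg_of_tendsto (l := (atTop : Filter D))
      (T := fun e : D => (e.1 : H →L[ℂ] H) - (d : H →L[ℂ] H)) ?_
      (fun ξ => by simpa using (hT₀ ξ).sub_const _)
    filter_upwards [eventually_ge_atTop (⟨d, hd⟩ : D)] with e he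
    exact (sub_nonneg (a := (e.1 : H →L[ℂ] H))).2 he
  have h1 : (x : H →L[ℂ] H) ≤ T₀ := hx.2 (show (⟨T₀, hmem⟩ : M.toStarSubalgebra) ∈ upperBounds D
    from hub)
  have h2 : T₀ ≤ x := by
    rw [← sub_nonneg]
    exact nonneg_of_tendsto (l := (atTop : Filter D))
      (T := fun e : D => (x : H →L[ℂ] H) - (e.1 : H →L[ℂ] H))
      (Eventually.of_forall fun e => (sub_nonneg (a := (x : H →L[ℂ] H))).2 (hx.1 e.2))
      (fun ξ => by simpa using (hT₀ ξ).const_sub _)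
  rw [le_antisymm h1 h2]
  exact hT₀ ξ

/-! ### The projections `P_t` -/

namespace VNFiltration

variable (F : VNFiltration H) (Ω : H)

theorem isStarProjection_P (t : ℝ≥0∞) : IsStarProjection (F.P Ω t) :=
  isStarProjection_starProjection

/-- The closure of A_tΩ is invariant under the self-adjoint algebra A_t. -/
theorem P_mem_commutant (t : ℝ≥0∞) : F.P Ω t ∈ (F.alg t).commutant := by
  rw [VonNeumannAlgebra.IsStarProjection.mem_iff (F.isStarProjection_P Ω t),
    VonNeumannAlgebra.commutant_commutant]
  intro y hy
  rw [P, Submodule.range_starProjection, Module.End.mem_invtSubmodule]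
  refine Submodule.topologicalClosure_minimal _ ?_
    ((Submodule.isClosed_topologicalClosure _).preimage y.continuous)
  rintro _ ⟨a, ha, rfl⟩
  exact Submodule.le_topologicalClosure _ ⟨y * a, (F.alg t).mul_mem' hy ha, rfl⟩

theorem P_comm {t : ℝ≥0∞} {a : H →L[ℂ] H} (ha : a ∈ F.alg t) : a * F.P Ω t = F.P Ω t * a :=
  VonNeumannAlgebra.mem_commutant_iff.1 (F.P_mem_commutant Ω t) a ha

theorem P_mul_P {s t : ℝ≥0∞} (h : s ≤ t) : F.P Ω t * F.P Ω s = F.P Ω s := by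
  have hle : orbit (F.alg s) Ω ≤ orbit (F.alg t) Ω := Submodule.map_mono (F.mono h)
  ext ξ
  exact Submodule.starProjection_eq_self_iff.2
    (Submodule.topologicalClosure_mono hle (Submodule.starProjection_apply_mem _ ξ))

theorem P_apply_of_mem {t : ℝ≥0∞} {a : H →L[ℂ] H} (ha : a ∈ F.alg t) : F.P Ω t (a Ω) = a Ω :=
  Submodule.starProjection_eq_self_iff.2 (Submodule.le_topologicalClosure _ ⟨a, ha, rfl⟩)

end VNFiltration

/-! ### The time projection as a strong limit -/

/-- Projections onto a decreasing net of closed subspaces converge strongly to the projection onto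
the intersection. -/
theorem tendsto_starProjection_iInf {ι : Type*} [Preorder ι] (U : ι → Submodule ℂ H)
    [∀ i, (U i).HasOrthogonalProjection] [(⨅ i, U i).topologicalClosure.HasOrthogonalProjection]
    (hU : Antitone U) (ξ : H) :
    Tendsto (fun i => (U i).starProjection ξ) atTop
      (𝓝 ((⨅ i, U i).topologicalClosure.starProjection ξ)) := by
  -- Orthogonal complements turn the decreasing net into an increasing one.
  have h := Submodule.starProjection_tendsto_closure_iSup (fun i => (U i)ᗮ)
    (fun i j hij => Submodule.orthogonal_le (hU hij)) ξ
  have h1 : (⨅ i, U i).topologicalClosure = ((⨆ i, (U i)ᗮ).topologicalClosure)ᗮ := by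
    have hcl : (⨅ i, U i) = (⨆ i, (U i)ᗮ)ᗮ := by
      rw [← Submodule.iInf_orthogonal]
      exact iInf_congr fun i => (Submodule.orthogonal_orthogonal (U i)).symm
    rw [Submodule.orthogonal_closure, hcl]
    exact (Submodule.isClosed_orthogonal _).submodule_topologicalClosure_eq
  have h2 : (⨅ i, U i).topologicalClosure.starProjection ξ =
      ξ - (⨆ i, (U i)ᗮ).topologicalClosure.starProjection ξ := by
    simp_rw [h1]
    rw [Submodule.starProjection_orthogonal']
    rfl
  rw [h2]
  refine (h.const_sub ξ).congr fun i => ?_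
  rw [Submodule.starProjection_orthogonal']
  simp

/-! ### Partitions containing a prescribed time -/

instance (u : ℝ≥0∞) [h : Fact (0 < u)] : Nonempty (TimePartition u) :=
  ⟨⟨1, ![0, u], by
    intro i j hij
    fin_cases i <;> fin_cases j <;> simp_all [h.out], rfl, rfl⟩⟩

/-- Statements about q_s are checked only on partitions through s; this makes them hold eventually,
hence in the limit. -/
theorem TimePartition.eventually_mem {u s : ℝ≥0∞} (hs : s ≤ u) [Fact (0 < u)] :
    ∀ᶠ θ : TimePartition u in atTop, s ∈ Set.range θ.t := by
  obtain ⟨η, hη⟩ : ∃ η : TimePartition u, s ∈ Set.range η.t := by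
    rcases eq_or_lt_of_le hs with rfl | hsu
    · exact ⟨Classical.arbitrary _, _, (Classical.arbitrary (TimePartition s)).last⟩
    rcases eq_or_lt_of_le (zero_le (a := s)) with rfl | h0
    · exact ⟨Classical.arbitrary _, _, (Classical.arbitrary (TimePartition u)).first⟩
    exact ⟨⟨2, ![0, s, u], by
      have := h0.trans hsu
      intro i j hij
      fin_cases i <;> fin_cases j <;> simp_all, rfl, rfl⟩, 1, rfl⟩
  filter_upwards [eventually_ge_atTop η] with θ hθ
  exact hθ hη

theorem TimePartition.le_of_mem {u s : ℝ≥0∞} {θ : TimePartition u} (hs : s ∈ Set.range θ.t) : s ≤ u := by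
  obtain ⟨k, rfl⟩ := hs
  exact (θ.strictMono.monotone (Fin.le_last k)).trans θ.last.le

/-! ### Increments of a stopping time and the projections of a partition -/

namespace StoppingTime

variable {F : VNFiltration H} (τ : StoppingTime F) (Ω : H) {u : ℝ≥0∞}

theorem q_mul_q {s t : ℝ≥0∞} (h : s ≤ t) : τ.q s * τ.q t = τ.q s :=
  ((τ.proj s).le_iff_mul_eq_left (τ.proj t)).1 (τ.mono h)

theorem q_mul_q' {s t : ℝ≥0∞} (h : s ≤ t) : τ.q t * τ.q s = τ.q s :=
  ((τ.proj s).le_iff_mul_eq_right (τ.proj t)).1 (τ.mono h)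

/-- The increment `q_{tᵢ} - q_{tᵢ₋₁}` of a stopping time along a partition. -/
noncomputable def incr (θ : TimePartition u) (i : Fin θ.n) : H →L[ℂ] H :=
  τ.q (θ.t i.succ) - τ.q (θ.t i.castSucc)

theorem incr_mem (θ : TimePartition u) (i : Fin θ.n) : τ.incr θ i ∈ F.alg (θ.t i.succ) :=
  sub_mem (τ.adapted _)
    (F.mono (θ.strictMono.monotone Fin.castSucc_lt_succ.le) (τ.adapted _))

theorem isSelfAdjoint_incr (θ : TimePartition u) (i : Fin θ.n) : IsSelfAdjoint (τ.incr θ i) :=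
  (τ.proj _).isSelfAdjoint.sub (τ.proj _).isSelfAdjoint

theorem incr_mul_self (θ : TimePartition u) (i : Fin θ.n) :
    τ.incr θ i * τ.incr θ i = τ.incr θ i := by
  have h : θ.t i.castSucc ≤ θ.t i.succ := θ.strictMono.monotone Fin.castSucc_lt_succ.le
  simp only [incr, sub_mul, mul_sub, τ.q_mul_q h, τ.q_mul_q' h, τ.q_mul_q le_rfl]
  abel

theorem q_mul_incr (θ : TimePartition u) (i : Fin θ.n) (k : Fin (θ.n + 1)) :
    τ.q (θ.t k) * τ.incr θ i = if i.succ ≤ k then τ.incr θ i else 0 := by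
  split_ifs with h
  · rw [incr, mul_sub, τ.q_mul_q' (θ.strictMono.monotone h),
      τ.q_mul_q' (θ.strictMono.monotone (Fin.castSucc_lt_succ.le.trans h))]
  · have h' : k ≤ i.castSucc := by simpa [Fin.le_castSucc_iff] using h
    rw [incr, mul_sub, τ.q_mul_q (θ.strictMono.monotone h'),
      τ.q_mul_q (θ.strictMono.monotone (h'.trans Fin.castSucc_lt_succ.le)), sub_self]

theorem incr_mul_q (θ : TimePartition u) (i : Fin θ.n) (k : Fin (θ.n + 1)) :
    τ.incr θ i * τ.q (θ.t k) = if i.succ ≤ k then τ.incr θ i else 0 := by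
  have h := congrArg star (τ.q_mul_incr θ i k)
  rw [star_mul, (τ.proj _).isSelfAdjoint.star_eq, (τ.isSelfAdjoint_incr θ i).star_eq] at h
  rw [h]
  split_ifs
  · exact (τ.isSelfAdjoint_incr θ i).star_eq
  · exact star_zero _

theorem q_top_mul_incr (θ : TimePartition u) (i : Fin θ.n) : τ.q u * τ.incr θ i = τ.incr θ i := by
  have h := τ.q_mul_incr θ i (Fin.last _)
  rwa [θ.last, if_pos (Fin.le_last _)] at h

theorem sum_incr (θ : TimePartition u) : ∑ i, τ.incr θ i = τ.q u := by
  have key : ∀ (n : ℕ) (f : Fin (n + 1) → H →L[ℂ] H),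
      ∑ i : Fin n, (f i.succ - f i.castSucc) = f (Fin.last n) - f 0 := by
    intro n f
    have h1 := Fin.sum_univ_succ f
    have h2 := Fin.sum_univ_castSucc f
    rw [Finset.sum_sub_distrib, sub_eq_sub_iff_add_eq_add, add_comm (f (Fin.last n)), ← h2, h1,
      add_comm]
  have h := key θ.n fun k => τ.q (θ.t k)
  rw [θ.first, θ.last, τ.zero, sub_zero] at h
  exact h

theorem partSum_eq (θ : TimePartition u) :
    τ.partSum Ω θ = ∑ i, τ.incr θ i * F.P Ω (θ.t i.succ) := rfl

theorem q_top_mul_partSum (θ : TimePartition u) : τ.q u * τ.partSum Ω θ = τ.partSum Ω θ := by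
  simp_rw [partSum_eq, Finset.mul_sum, ← mul_assoc, q_top_mul_incr]

theorem isSelfAdjoint_partSum (θ : TimePartition u) : IsSelfAdjoint (τ.partSum Ω θ) := by
  rw [partSum_eq, IsSelfAdjoint, star_sum]
  refine Finset.sum_congr rfl fun i _ => ?_
  rw [star_mul, (τ.isSelfAdjoint_incr θ i).star_eq,
    (F.isStarProjection_P Ω _).isSelfAdjoint.star_eq, F.P_comm Ω (τ.incr_mem θ i)]

/-- Multiplication by q_{t_k} keeps only the increments up to t_k, and their projections P_{tᵢ} lie
below P_{t_k}. -/
theorem P_mul_q_mul_partSum (θ : TimePartition u) (k : Fin (θ.n + 1)) :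
    F.P Ω (θ.t k) * (τ.q (θ.t k) * τ.partSum Ω θ) = τ.q (θ.t k) * τ.partSum Ω θ := by
  simp_rw [partSum_eq, Finset.mul_sum, ← mul_assoc (τ.q (θ.t k)), q_mul_incr]
  refine Finset.sum_congr rfl fun i _ => ?_
  split_ifs with h
  · rw [F.P_comm Ω (τ.incr_mem θ i), ← mul_assoc, F.P_mul_P Ω (θ.strictMono.monotone h)]
  · simp

theorem partSum_apply_eq_self {θ : TimePartition u} {ξ : H} (hu : τ.q u ξ = ξ)
    (h : ∀ s ∈ Set.range θ.t, F.P Ω s (τ.q s ξ) = τ.q s ξ) : τ.partSum Ω θ ξ = ξ := by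
  have key : ∀ i, (τ.incr θ i * F.P Ω (θ.t i.succ)) ξ = τ.incr θ i ξ := by
    intro i
    have h1 := h _ ⟨i.succ, rfl⟩
    have h2 := h _ ⟨i.castSucc, rfl⟩
    -- The vector q_{tᵢ₋₁}ξ is fixed by P_{tᵢ₋₁}, hence by the larger P_{tᵢ}; so P_{tᵢ} fixes Δᵢξ.
    have h3 := congrArg (· (τ.q (θ.t i.castSucc) ξ))
      (F.P_mul_P Ω (θ.strictMono.monotone (Fin.castSucc_lt_succ (i := i)).le))
    simp only [mul_apply_eq_comp, h2] at h3
    rw [F.P_comm Ω (τ.incr_mem θ i), mul_apply_eq_comp, incr, sub_apply, map_sub,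
      h1, h3]
  rw [partSum_eq, sum_apply, Finset.sum_congr rfl fun i _ => key i,
    ← sum_apply, sum_incr, hu]

/-- The conditions refer to the points of θ one at a time, which makes the range visibly antitone
under refinement. -/
theorem mem_range_partSum {θ : TimePartition u} {ξ : H} :
    ξ ∈ (τ.partSum Ω θ).toLinearMap.range ↔
      τ.q u ξ = ξ ∧ ∀ s ∈ Set.range θ.t, F.P Ω s (τ.q s ξ) = τ.q s ξ := by
  constructor
  · rintro ⟨η, rfl⟩
    refine ⟨congrArg (· η) (τ.q_top_mul_partSum Ω θ), ?_⟩
    rintro _ ⟨k, rfl⟩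
    exact congrArg (· η) (τ.P_mul_q_mul_partSum Ω θ k)
  · rintro ⟨h1, h2⟩
    exact ⟨ξ, τ.partSum_apply_eq_self Ω h1 h2⟩

theorem isStarProjection_partSum (θ : TimePartition u) : IsStarProjection (τ.partSum Ω θ) := by
  refine ⟨?_, τ.isSelfAdjoint_partSum Ω θ⟩
  ext ξ
  obtain ⟨h1, h2⟩ := (τ.mem_range_partSum Ω (θ := θ)).1 ⟨ξ, rfl⟩
  exact τ.partSum_apply_eq_self Ω h1 h2

theorem isStrongLimit : τ.IsStrongLimit Ω u := by
  intro ξ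
  have hproj := fun θ : TimePartition u =>
    isStarProjection_iff_eq_starProjection_range.1 (τ.isStarProjection_partSum Ω θ)
  choose hop heq using hproj
  have h := tendsto_starProjection_iInf
    (fun θ : TimePartition u => (τ.partSum Ω θ).toLinearMap.range) ?_ ξ
  · refine h.congr fun θ => ?_
    exact congrArg (· ξ) (heq θ).symm
  · intro θ η hθη ξ hξ
    rw [mem_range_partSum] at hξ ⊢
    exact ⟨hξ.1, fun s hs => hξ.2 s (hθη hs)⟩

/-- Every P_t fixes Ω, so each partition sum applied to Ω telescopes to q_uΩ. -/
theorem timeProj_apply_self [Fact (0 < u)] : τ.timeProj Ω u Ω = τ.q u Ω := by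
  refine tendsto_nhds_unique (τ.isStrongLimit Ω Ω) (tendsto_const_nhds.congr fun θ => ?_)
  simp_rw [partSum_eq, ← sum_incr τ θ, sum_apply, mul_apply_eq_comp]
  refine Finset.sum_congr rfl fun i _ => ?_
  have := F.P_apply_of_mem Ω (one_mem (F.alg (θ.t i.succ)))
  rw [one_apply_eq_self] at this
  rw [this]

end StoppingTime

/-! ### The conditional expectation of a stopping time -/

/-- A family of positive projections of the ambient algebra onto the algebras of a filtration, one
for each time in `[0, ∞]`, which are bimodule maps and are implemented by the projections `P_t`. -/
structure CondExpFamily (F : VNFiltration H) (Ω : H) where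
  e : ℝ≥0∞ → (F.alg ⊤).toStarSubalgebra →ₗ[ℂ] (H →L[ℂ] H)
  mem : ∀ t x, e t x ∈ F.alg t
  fixes : ∀ t (x : (F.alg ⊤).toStarSubalgebra), (x : H →L[ℂ] H) ∈ F.alg t → e t x = x
  nonneg : ∀ t (x : (F.alg ⊤).toStarSubalgebra), 0 ≤ (x : H →L[ℂ] H) → 0 ≤ e t x
  bimodule : ∀ t (a b : H →L[ℂ] H), a ∈ F.alg t → b ∈ F.alg t →
    ∀ x y : (F.alg ⊤).toStarSubalgebra, (y : H →L[ℂ] H) = a * x * b → e t y = a * e t x * b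
  P_apply : ∀ t (x : (F.alg ⊤).toStarSubalgebra), F.P Ω t ((x : H →L[ℂ] H) Ω) = e t x Ω

theorem VNFiltration.HasCondExps.nonempty_family {F : VNFiltration H} {Ω : H}
    (hF : F.HasCondExps Ω) : Nonempty (CondExpFamily F Ω) := by
  have key : ∀ t : ℝ≥0∞, ∃ e : (F.alg ⊤).toStarSubalgebra →ₗ[ℂ] (H →L[ℂ] H),
      (∀ x, e x ∈ F.alg t) ∧
      (∀ (x : (F.alg ⊤).toStarSubalgebra), (x : H →L[ℂ] H) ∈ F.alg t → e x = x) ∧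
      (∀ (x : (F.alg ⊤).toStarSubalgebra), 0 ≤ (x : H →L[ℂ] H) → 0 ≤ e x) ∧
      (∀ a b : H →L[ℂ] H, a ∈ F.alg t → b ∈ F.alg t →
        ∀ x y : (F.alg ⊤).toStarSubalgebra, (y : H →L[ℂ] H) = a * x * b → e y = a * e x * b) ∧
      ∀ (x : (F.alg ⊤).toStarSubalgebra), F.P Ω t ((x : H →L[ℂ] H) Ω) = e x Ω := by
    intro t
    induction t with
    -- Expectations are assumed only at finite times; at infinity the identity serves.
    | top =>
      exact ⟨(F.alg ⊤).toStarSubalgebra.subtype.toLinearMap, fun x => x.2, fun _ _ => rfl,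
        fun _ h => h, fun _ _ _ _ _ _ h => h, fun x => F.P_apply_of_mem Ω x.2⟩
    | coe t =>
      obtain ⟨E, hE, -, hΩ⟩ := hF t
      exact ⟨{ toFun := fun x => E x
               map_add' := fun x y => by rw [map_add]; rfl
               map_smul' := fun c x => by rw [map_smul]; rfl },
        fun x => (E x).2, hE.fixes, hE.nonneg, fun a b ha hb => hE.bimodule ⟨a, ha⟩ ⟨b, hb⟩,
        F.P_apply_of_condExp Ω t E hE hΩ⟩
  choose e h1 h2 h3 h4 h5 using key
  exact ⟨⟨e, h1, h2, h3, h4, h5⟩⟩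

/-! ### The maps attached to partitions and their limit -/

namespace StoppingTime

variable {F : VNFiltration H} (τ : StoppingTime F) {Ω : H} {u : ℝ≥0∞}

theorem A_le_B {x : H →L[ℂ] H} (hx : x ∈ τ.A u) : x ∈ τ.B u :=
  ⟨hx.1, fun t ht => (hx.2 t ht).1⟩

/-- The inclusion of `B_τ(u)` in the ambient algebra. -/
noncomputable def inclB (u : ℝ≥0∞) :
    (τ.B u).toStarSubalgebra →ₗ[ℂ] (F.alg ⊤).toStarSubalgebra where
  toFun x := ⟨x, x.2.1⟩
  map_add' _ _ := rfl
  map_smul' _ _ := rfl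

@[simp]
theorem coe_inclB (x : (τ.B u).toStarSubalgebra) : (τ.inclB u x : H →L[ℂ] H) = x := rfl

/-- The map `x ↦ ∑ᵢ (q_{tᵢ} - q_{tᵢ₋₁}) E_{tᵢ}(x)` on `B_τ(u)` given by a partition. -/
noncomputable def partExp (𝓔 : CondExpFamily F Ω) (θ : TimePartition u) :
    (τ.B u).toStarSubalgebra →ₗ[ℂ] (H →L[ℂ] H) :=
  ∑ i, (LinearMap.mulLeft ℂ (τ.incr θ i)) ∘ₗ 𝓔.e (θ.t i.succ) ∘ₗ τ.inclB u

variable (𝓔 : CondExpFamily F Ω)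

theorem partExp_apply (θ : TimePartition u) (x : (τ.B u).toStarSubalgebra) :
    τ.partExp 𝓔 θ x = ∑ i, τ.incr θ i * 𝓔.e (θ.t i.succ) (τ.inclB u x) := by
  simp [partExp]

theorem incr_comm {x : H →L[ℂ] H} (hx : x ∈ τ.B u) (θ : TimePartition u) (i : Fin θ.n) :
    τ.incr θ i * x = x * τ.incr θ i := by
  rw [incr, mul_sub, sub_mul, hx.2 _ (TimePartition.le_of_mem ⟨_, rfl⟩), hx.2 _ (TimePartition.le_of_mem ⟨_, rfl⟩)]

/-- Apply the expectation to Δᵢx = xΔᵢ, taking Δᵢ out on the left and on the right. -/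
theorem incr_mul_exp (θ : TimePartition u) (i : Fin θ.n) (x : (τ.B u).toStarSubalgebra) :
    τ.incr θ i * 𝓔.e (θ.t i.succ) (τ.inclB u x) =
      𝓔.e (θ.t i.succ) (τ.inclB u x) * τ.incr θ i := by
  have hm := τ.incr_mem θ i
  have hxm : τ.incr θ i * (x : H →L[ℂ] H) ∈ F.alg ⊤ := mul_mem (F.mono le_top hm) x.2.1
  have h1 := 𝓔.bimodule _ _ _ hm (one_mem _) (τ.inclB u x) ⟨_, hxm⟩ (by simp)
  have h2 := 𝓔.bimodule _ _ _ (one_mem _) hm (τ.inclB u x) ⟨_, hxm⟩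
    (by simp [τ.incr_comm x.2 θ i])
  rw [mul_one] at h1
  rw [one_mul] at h2
  exact h1.symm.trans h2

theorem incr_mul_exp_eq_conj (θ : TimePartition u) (i : Fin θ.n) (x : (τ.B u).toStarSubalgebra) :
    τ.incr θ i * 𝓔.e (θ.t i.succ) (τ.inclB u x) =
      star (τ.incr θ i) * 𝓔.e (θ.t i.succ) (τ.inclB u x) * τ.incr θ i := by
  rw [(τ.isSelfAdjoint_incr θ i).star_eq, mul_assoc, ← τ.incr_mul_exp, ← mul_assoc,
    τ.incr_mul_self]

theorem partExp_nonneg (θ : TimePartition u) {x : (τ.B u).toStarSubalgebra}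
    (hx : 0 ≤ (x : H →L[ℂ] H)) : 0 ≤ τ.partExp 𝓔 θ x := by
  rw [partExp_apply]
  refine Finset.sum_nonneg fun i _ => ?_
  rw [incr_mul_exp_eq_conj]
  exact star_left_conjugate_nonneg (𝓔.nonneg _ _ hx) _

theorem partExp_one (θ : TimePartition u) : τ.partExp 𝓔 θ 1 = τ.q u := by
  rw [partExp_apply, ← τ.sum_incr θ]
  refine Finset.sum_congr rfl fun i _ => ?_
  rw [𝓔.fixes _ _ (one_mem (F.alg _))]
  exact mul_one _

/-- For x ≥ 0, positivity gives 0 ≤ E_θ(x) ≤ ‖x‖q_u. Self-adjoint x reduce to this by adding ‖x‖·1,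
and general x by real and imaginary parts. -/
theorem exists_norm_partExp_le (x : (τ.B u).toStarSubalgebra) :
    ∃ C, ∀ θ : TimePartition u, ‖τ.partExp 𝓔 θ x‖ ≤ C := by
  have hq : τ.q u ≤ 1 := (τ.proj u).le_one
  have hpos : ∀ x : (τ.B u).toStarSubalgebra, 0 ≤ (x : H →L[ℂ] H) →
      ∃ C, ∀ θ : TimePartition u, ‖τ.partExp 𝓔 θ x‖ ≤ C := by
    intro x hx
    refine ⟨‖((‖(x : H →L[ℂ] H)‖ : ℂ) • τ.q u : H →L[ℂ] H)‖, fun θ => ?_⟩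
    refine CStarAlgebra.norm_le_norm_of_nonneg_of_le (τ.partExp_nonneg 𝓔 θ hx) ?_
    have h : 0 ≤ τ.partExp 𝓔 θ ((‖(x : H →L[ℂ] H)‖ : ℂ) • 1 - x) := by
      refine τ.partExp_nonneg 𝓔 θ ?_
      have := (IsSelfAdjoint.of_nonneg hx).le_algebraMap_norm_self
      rw [Algebra.algebraMap_eq_smul_one] at this
      exact sub_nonneg.2 this
    rwa [map_sub, map_smul, partExp_one, sub_nonneg] at h
  have hsa : ∀ x : (τ.B u).toStarSubalgebra, IsSelfAdjoint (x : H →L[ℂ] H) →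
      ∃ C, ∀ θ : TimePartition u, ‖τ.partExp 𝓔 θ x‖ ≤ C := by
    intro x hx
    obtain ⟨C, hC⟩ := hpos (x + (‖(x : H →L[ℂ] H)‖ : ℂ) • 1) (by
      have := hx.neg_algebraMap_norm_le_self
      rw [Algebra.algebraMap_eq_smul_one, neg_le_iff_add_nonneg] at this
      exact this)
    refine ⟨C + ‖((‖(x : H →L[ℂ] H)‖ : ℂ) • τ.q u : H →L[ℂ] H)‖, fun θ => ?_⟩
    have h : τ.partExp 𝓔 θ x = τ.partExp 𝓔 θ (x + (‖(x : H →L[ℂ] H)‖ : ℂ) • 1) -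
        (‖(x : H →L[ℂ] H)‖ : ℂ) • τ.q u := by
      rw [map_add, map_smul, partExp_one, add_sub_cancel_right]
    rw [h]
    exact (norm_sub_le _ _).trans (by gcongr; exact hC θ)
  obtain ⟨C₁, h₁⟩ := hsa (realPart x : (τ.B u).toStarSubalgebra)
    (congrArg Subtype.val (realPart x).2)
  obtain ⟨C₂, h₂⟩ := hsa (imaginaryPart x : (τ.B u).toStarSubalgebra)
    (congrArg Subtype.val (imaginaryPart x).2)
  refine ⟨C₁ + C₂, fun θ => ?_⟩
  have h := congrArg (τ.partExp 𝓔 θ) (realPart_add_I_smul_imaginaryPart x)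
  rw [map_add, map_smul] at h
  rw [← h]
  refine (norm_add_le _ _).trans ?_
  rw [norm_smul, Complex.norm_I, one_mul]
  exact add_le_add (h₁ θ) (h₂ θ)

/-- Only terms with tᵢ ≤ t_k survive, and these already lie in A_{t_k}. -/
theorem q_mul_partExp (θ : TimePartition u) (k : Fin (θ.n + 1)) (x : (τ.B u).toStarSubalgebra) :
    τ.q (θ.t k) * τ.partExp 𝓔 θ x ∈ F.alg (θ.t k) := by
  simp_rw [partExp_apply, Finset.mul_sum, ← mul_assoc, q_mul_incr]
  refine sum_mem fun i _ => ?_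
  split_ifs with h
  · exact F.mono (θ.strictMono.monotone h) (mul_mem (τ.incr_mem θ i) (𝓔.mem _ _))
  · rw [zero_mul]
    exact zero_mem _

theorem partExp_mul_q (θ : TimePartition u) (k : Fin (θ.n + 1)) (x : (τ.B u).toStarSubalgebra) :
    τ.partExp 𝓔 θ x * τ.q (θ.t k) = τ.q (θ.t k) * τ.partExp 𝓔 θ x := by
  simp_rw [partExp_apply, Finset.mul_sum, Finset.sum_mul]
  refine Finset.sum_congr rfl fun i _ => ?_
  rw [← mul_assoc, q_mul_incr, incr_mul_exp, mul_assoc, incr_mul_q]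
  split_ifs
  · rw [incr_mul_exp]
  · rw [mul_zero, zero_mul]

theorem partExp_mem_top (θ : TimePartition u) (x : (τ.B u).toStarSubalgebra) :
    τ.partExp 𝓔 θ x ∈ F.alg ⊤ := by
  rw [partExp_apply]
  exact sum_mem fun i _ => F.mono le_top (mul_mem (τ.incr_mem θ i) (𝓔.mem _ _))

theorem q_top_mul_partExp (θ : TimePartition u) (x : (τ.B u).toStarSubalgebra) :
    τ.q u * τ.partExp 𝓔 θ x = τ.partExp 𝓔 θ x := by
  simp_rw [partExp_apply, Finset.mul_sum, ← mul_assoc, q_top_mul_incr]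

theorem partExp_apply_vec (θ : TimePartition u) (x : (τ.B u).toStarSubalgebra) :
    τ.partExp 𝓔 θ x Ω = τ.partSum Ω θ ((x : H →L[ℂ] H) Ω) := by
  simp_rw [partExp_apply, partSum_eq, sum_apply, mul_apply_eq_comp, ← 𝓔.P_apply, coe_inclB]

theorem incr_mul_mem {a : H →L[ℂ] H} (ha : a ∈ τ.A u) (θ : TimePartition u) (i : Fin θ.n) :
    τ.incr θ i * a ∈ F.alg (θ.t i.succ) := by
  rw [incr, sub_mul]
  exact sub_mem (ha.2 _ (TimePartition.le_of_mem ⟨_, rfl⟩)).2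
    (F.mono (θ.strictMono.monotone Fin.castSucc_lt_succ.le) (ha.2 _ (TimePartition.le_of_mem ⟨_, rfl⟩)).2)

/-- Neither a nor b need lie in A_{tᵢ}, but Δᵢa and Δᵢb do. The idempotent Δᵢ is therefore
duplicated and moved next to both factors before the bimodule property of E_{tᵢ} is applied. -/
theorem partExp_bimodule (θ : TimePartition u) {a b : H →L[ℂ] H} (ha : a ∈ τ.A u)
    (hb : b ∈ τ.A u) (x y : (τ.B u).toStarSubalgebra) (hy : (y : H →L[ℂ] H) = a * x * b) :
    τ.partExp 𝓔 θ y = a * τ.partExp 𝓔 θ x * b := by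
  simp_rw [partExp_apply, Finset.mul_sum, Finset.sum_mul]
  refine Finset.sum_congr rfl fun i _ => ?_
  set Δ := τ.incr θ i
  have hΔ : Δ * Δ = Δ := τ.incr_mul_self θ i
  have ca : Δ * a = a * Δ := τ.incr_comm (τ.A_le_B ha) θ i
  have cb : Δ * b = b * Δ := τ.incr_comm (τ.A_le_B hb) θ i
  have cx : Δ * (x : H →L[ℂ] H) = x * Δ := τ.incr_comm x.2 θ i
  have hm : Δ ∈ F.alg (θ.t i.succ) := τ.incr_mem θ i
  have hym : Δ * (y : H →L[ℂ] H) ∈ F.alg ⊤ := mul_mem (F.mono le_top hm) y.2.1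
  have h1 := 𝓔.bimodule _ _ _ hm (one_mem _) (τ.inclB u y) ⟨_, hym⟩ (by simp)
  have h2 := 𝓔.bimodule _ _ _ (τ.incr_mul_mem ha θ i) (τ.incr_mul_mem hb θ i) (τ.inclB u x)
    ⟨_, hym⟩ (by
      show Δ * (y : H →L[ℂ] H) = Δ * a * x * (Δ * b)
      calc Δ * (y : H →L[ℂ] H) = Δ * Δ * a * x * b := by rw [hy, hΔ]; simp only [mul_assoc]
        _ = Δ * (Δ * a) * x * b := by simp only [mul_assoc]
        _ = Δ * (a * Δ) * x * b := by rw [ca]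
        _ = Δ * a * (Δ * x) * b := by simp only [mul_assoc]
        _ = Δ * a * x * (Δ * b) := by rw [cx]; simp only [mul_assoc])
  rw [mul_one] at h1
  rw [← h1, h2, ca, mul_assoc a Δ]
  have he := τ.incr_mul_exp 𝓔 θ i x
  rw [mul_assoc a, mul_assoc a]
  congr 1
  rw [← mul_assoc, mul_assoc Δ _ Δ, ← he, ← mul_assoc, hΔ]

theorem partExp_eq_self (θ : TimePartition u) (x : (τ.B u).toStarSubalgebra)
    (hx : (x : H →L[ℂ] H) ∈ τ.A u) (hq : τ.q u * x = x) : τ.partExp 𝓔 θ x = x := by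
  conv_rhs => rw [← hq, ← τ.sum_incr θ, Finset.sum_mul]
  rw [partExp_apply]
  refine Finset.sum_congr rfl fun i _ => ?_
  have hm := τ.incr_mul_mem hx θ i
  have h1 := 𝓔.bimodule _ _ _ (τ.incr_mem θ i) (one_mem _) (τ.inclB u x)
    ⟨_, F.mono le_top hm⟩ (by simp)
  rw [mul_one] at h1
  rw [← h1]
  exact 𝓔.fixes _ _ hm

/-- The maps `partExp` converge strongly along refinement of partitions. -/
theorem exists_limitExp [Fact (0 < u)] (hsep : IsSeparatingVector (F.alg ⊤) Ω) :
    ∃ E : (τ.B u).toStarSubalgebra →ₗ[ℂ] (H →L[ℂ] H),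
      ∀ x ξ, Tendsto (fun θ => τ.partExp 𝓔 θ x ξ) atTop (𝓝 (E x ξ)) := by
  have key : ∀ x : (τ.B u).toStarSubalgebra, ∃ y : H →L[ℂ] H,
      ∀ ξ, Tendsto (fun θ => τ.partExp 𝓔 θ x ξ) atTop (𝓝 (y ξ)) := by
    intro x
    obtain ⟨C, hC⟩ := τ.exists_norm_partExp_le 𝓔 x
    refine exists_strongLimit_of_dense _ (Eventually.of_forall hC) hsep.dense_commutant ?_
    rintro _ ⟨a, ha, rfl⟩
    -- Since a commutes with E_θ(x), the limit at aΩ is a applied to the limit at Ω.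
    refine ⟨a (τ.timeProj Ω u ((x : H →L[ℂ] H) Ω)), ?_⟩
    refine ((a.continuous.tendsto _).comp (τ.isStrongLimit Ω _)).congr fun θ => ?_
    rw [Function.comp_apply, ← partExp_apply_vec τ 𝓔]
    exact (congrArg (· Ω) (VonNeumannAlgebra.mem_commutant_iff.1 ha _
      (τ.partExp_mem_top 𝓔 θ x))).symm
  choose f hf using key
  refine ⟨{ toFun := f, map_add' := fun x y => ?_, map_smul' := fun c x => ?_ }, hf⟩
  · ext ξ
    exact tendsto_nhds_unique (hf (x + y) ξ) (by simpa using (hf x ξ).add (hf y ξ))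
  · ext ξ
    exact tendsto_nhds_unique (hf (c • x) ξ) (by simpa using (hf x ξ).const_smul c)

/-- The conditional expectation of `B_τ(u)` onto the algebra `{z ∈ A_τ(u) : q_u z = z}`. -/
theorem exists_condExp (hu : 0 < u) (hsep : IsSeparatingVector (F.alg ⊤) Ω)
    (hF : F.HasCondExps Ω) (N : NonUnitalStarSubalgebra ℂ (H →L[ℂ] H))
    (hN : ∀ z, z ∈ N ↔ z ∈ τ.A u ∧ τ.q u * z = z) :
    ∃ E : (τ.B u).toStarSubalgebra →ₗ[ℂ] N,
      (∀ x, (E x : H →L[ℂ] H) Ω = τ.timeProj Ω u ((x : H →L[ℂ] H) Ω)) ∧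
      IsCondExp (τ.B u) N E ∧ IsNormalMap (τ.B u) N E ∧
      (∀ x : (τ.B u).toStarSubalgebra, 0 ≤ (x : H →L[ℂ] H) → E x = 0 → τ.q u * x * τ.q u = 0) ∧
      ∀ x, vecState Ω (E x) = vecState Ω (τ.q u * x * τ.q u) := by
  have : Fact (0 < u) := ⟨hu⟩
  obtain ⟨𝓔⟩ := hF.nonempty_family
  obtain ⟨E₀, hE₀⟩ := τ.exists_limitExp (u := u) 𝓔 hsep
  have hvec : ∀ x, E₀ x Ω = τ.timeProj Ω u ((x : H →L[ℂ] H) Ω) := fun x =>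
    tendsto_nhds_unique (hE₀ x Ω)
      ((τ.isStrongLimit Ω _).congr fun θ => (τ.partExp_apply_vec 𝓔 θ x).symm)
  have htop : ∀ x, E₀ x ∈ F.alg ⊤ := fun x =>
    mem_of_tendsto_apply _ (Eventually.of_forall fun θ => τ.partExp_mem_top 𝓔 θ x) (hE₀ x)
  have hmem : ∀ x, E₀ x ∈ N := by
    refine fun x => (hN _).2 ⟨⟨htop x, fun t ht => ⟨?_, ?_⟩⟩, ?_⟩
    · ext ξ
      refine tendsto_nhds_unique_of_eventuallyEq (hE₀ x (τ.q t ξ))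
        (((τ.q t).continuous.tendsto _).comp (hE₀ x ξ)) ?_
      filter_upwards [TimePartition.eventually_mem ht] with θ hθ
      obtain ⟨k, rfl⟩ := hθ
      exact congrArg (· ξ) (τ.partExp_mul_q 𝓔 θ k x)
    · refine mem_of_tendsto_apply (l := (atTop : Filter (TimePartition u))) _
        (T := fun θ => τ.q t * τ.partExp 𝓔 θ x) ?_
        fun ξ => ((τ.q t).continuous.tendsto _).comp (hE₀ x ξ)
      filter_upwards [TimePartition.eventually_mem ht] with θ hθ
      obtain ⟨k, rfl⟩ := hθ
      exact τ.q_mul_partExp 𝓔 θ k x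
    · ext ξ
      refine tendsto_nhds_unique (((τ.q u).continuous.tendsto _).comp (hE₀ x ξ))
        ((hE₀ x ξ).congr fun θ => ?_)
      exact (congrArg (· ξ) (τ.q_top_mul_partExp 𝓔 θ x)).symm
  have hnn : ∀ x : (τ.B u).toStarSubalgebra, 0 ≤ (x : H →L[ℂ] H) → 0 ≤ E₀ x := fun x hx =>
    nonneg_of_tendsto (Eventually.of_forall fun θ => τ.partExp_nonneg 𝓔 θ hx) (hE₀ x)
  have hcomm : ∀ x : (τ.B u).toStarSubalgebra,
      τ.q u * (x : H →L[ℂ] H) * τ.q u = τ.q u * x := fun x => by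
    rw [mul_assoc, x.2.2 u le_rfl, ← mul_assoc, τ.q_mul_q le_rfl]
  have hstate : ∀ x, vecState Ω (E₀ x) = vecState Ω (τ.q u * x * τ.q u) := fun x => by
    have hM : IsSelfAdjoint (τ.timeProj Ω u) := isStarProjection_starProjection.isSelfAdjoint
    -- Self-adjointness moves M_τ(u) onto Ω, where it acts as q_u.
    rw [vecState, vecState, hvec, hcomm,
      ← (ContinuousLinearMap.isSelfAdjoint_iff_isSymmetric.1 hM).apply_clm,
      τ.timeProj_apply_self,
      (ContinuousLinearMap.isSelfAdjoint_iff_isSymmetric.1 (τ.proj u).isSelfAdjoint).apply_clm]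
    rfl
  refine ⟨{ toFun := fun x => ⟨E₀ x, hmem x⟩
            map_add' := fun x y => Subtype.ext (map_add E₀ x y)
            map_smul' := fun c x => Subtype.ext (map_smul E₀ c x) },
    hvec, ⟨fun y hy => τ.A_le_B ((hN y).1 hy).1, fun x hx => ?_, hnn, fun a b x y hy => ?_⟩,
    fun D x hne hdir _ hx => ⟨?_, fun z hz => ?_⟩, fun x hx h0 => ?_, hstate⟩
  · ext ξ
    refine tendsto_nhds_unique (hE₀ x ξ) (tendsto_const_nhds.congr fun θ => ?_)
    exact (congrArg (· ξ) (τ.partExp_eq_self 𝓔 θ x ((hN _).1 hx).1 ((hN _).1 hx).2)).symm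
  · ext ξ
    refine tendsto_nhds_unique (hE₀ y ξ)
      ((((a : H →L[ℂ] H).continuous.tendsto _).comp (hE₀ x ((b : H →L[ℂ] H) ξ))).congr
        fun θ => ?_)
    exact (congrArg (· ξ) (τ.partExp_bimodule 𝓔 θ ((hN _).1 a.2).1 ((hN _).1 b.2).1 x y hy)).symm
  · rintro _ ⟨d, hd, rfl⟩
    have h := hnn (x - d) (sub_nonneg.2 (hx.1 hd))
    rw [map_sub, sub_nonneg] at h
    exact h
  · obtain ⟨d₀, hd₀⟩ := hne
    have hle : ∀ d ∈ D, E₀ d ≤ z := fun d hd => hz ⟨d, hd, rfl⟩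
    have hlex : ∀ d ∈ D, E₀ d ≤ E₀ x := fun d hd => by
      have h := hnn (x - d) (sub_nonneg.2 (hx.1 hd))
      rwa [map_sub, sub_nonneg] at h
    -- The upper bound z is not assumed self-adjoint; z - E₀(x) is the difference of the positive
    -- elements z - E₀(d₀) and E₀(x) - E₀(d₀).
    have hsa : IsSelfAdjoint ((z : H →L[ℂ] H) - E₀ x) := by
      have := (IsSelfAdjoint.of_nonneg (sub_nonneg.2 (hle d₀ hd₀))).sub
        (IsSelfAdjoint.of_nonneg (sub_nonneg.2 (hlex d₀ hd₀)))
      rwa [sub_sub_sub_cancel_right] at this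
    have : Nonempty D := ⟨⟨d₀, hd₀⟩⟩
    have : IsDirectedOrder D := ⟨fun a b => by
      obtain ⟨c, hc, hac, hbc⟩ := hdir a a.2 b b.2
      exact ⟨⟨c, hc⟩, hac, hbc⟩⟩
    refine sub_nonneg.1 (nonneg_of_dense hsa hsep.dense_commutant ?_)
    rintro _ ⟨a, ha, rfl⟩
    have hac : ∀ y, E₀ y (a Ω) = a (τ.timeProj Ω u ((y : H →L[ℂ] H) Ω)) := fun y => by
      rw [← hvec]
      exact congrArg (· Ω) (VonNeumannAlgebra.mem_commutant_iff.1 ha _ (htop y))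
    -- Only the convergence dΩ → xΩ is needed, thanks to the formula for E₀(y)aΩ.
    have hlim : Tendsto (fun d : D => E₀ d (a Ω)) atTop (𝓝 (E₀ x (a Ω))) := by
      simp_rw [hac]
      exact ((a.continuous.comp (τ.timeProj Ω u).continuous).tendsto _).comp
        (tendsto_apply_of_isLUB ⟨d₀, hd₀⟩ hdir hx Ω)
    refine ge_of_tendsto' ((Complex.continuous_re.tendsto _).comp
      (tendsto_const_nhds.inner (hlim.const_sub ((z : H →L[ℂ] H) (a Ω))))) fun d => ?_
    have h := re_inner_le_of_le (sub_nonneg.2 (hle d d.2)) (a Ω)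
    simpa [inner_sub_right] using h
  · have hpos : 0 ≤ τ.q u * (x : H →L[ℂ] H) * τ.q u := by
      have := star_left_conjugate_nonneg hx (τ.q u)
      rwa [(τ.proj u).isSelfAdjoint.star_eq] at this
    -- A positive element with vanishing vector state annihilates Ω, which is separating.
    refine hsep _ (mul_mem (mul_mem (F.mono le_top (τ.adapted u)) x.2.1)
      (F.mono le_top (τ.adapted u))) (apply_eq_zero_of_nonneg_of_inner_eq_zero hpos ?_)
    have h := hstate x
    rw [show E₀ x = 0 from congrArg Subtype.val h0] at h
    exact h.symm.trans (by simp [vecState])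

theorem mem_reducedA_iff {F : VNFiltration H} (τ : StoppingTime F) (u : ℝ≥0∞) (z : H →L[ℂ] H) :
    z ∈ τ.reducedA u ↔ z ∈ τ.A u ∧ τ.q u * z = z := by
  have hq : τ.q u * τ.q u = τ.q u := τ.q_mul_q le_rfl
  constructor
  · rintro ⟨x, hx, rfl⟩
    exact ⟨mul_mem (mul_mem (τ.q_mem_A u) hx) (τ.q_mem_A u), by rw [← mul_assoc, ← mul_assoc, hq]⟩
  · rintro ⟨hz, h⟩
    exact ⟨z, hz, by rw [mul_assoc, (hz.2 u le_rfl).1, h, h]⟩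

end StoppingTime

end QuantumStopping

theorem theorem3 {H : Type*} [NormedAddCommGroup H] [InnerProductSpace ℂ H] [CompleteSpace H]
    (F : VNFiltration H) (Ω : H) (hΩ : ‖Ω‖ = 1)
    (hcyc : IsCyclicVector (F.alg ⊤) Ω) (hsep : IsSeparatingVector (F.alg ⊤) Ω)
    (hF : F.HasCondExps Ω) (τ : StoppingTime F) :
    (τ.IsStrongLimit Ω ⊤ ∧
      ∃ E : (τ.B ⊤).toStarSubalgebra →ₗ[ℂ] asAlg (τ.A ⊤),
        (∀ x, (E x : H →L[ℂ] H) Ω = τ.timeProj Ω ⊤ ((x : H →L[ℂ] H) Ω)) ∧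
        IsCondExp (τ.B ⊤) (asAlg (τ.A ⊤)) E ∧
        IsNormalMap (τ.B ⊤) (asAlg (τ.A ⊤)) E ∧
        IsFaithfulMap (τ.B ⊤) (asAlg (τ.A ⊤)) E ∧
        ∀ x, vecState Ω (E x) = vecState Ω x) ∧
    ∀ u : ℝ≥0∞, 0 < u →
      τ.IsStrongLimit Ω u ∧
      ∃ E : (τ.B u).toStarSubalgebra →ₗ[ℂ] τ.reducedA u,
        (∀ x, (E x : H →L[ℂ] H) Ω = τ.timeProj Ω u ((x : H →L[ℂ] H) Ω)) ∧
        IsCondExp (τ.B u) (τ.reducedA u) E ∧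
        IsNormalMap (τ.B u) (τ.reducedA u) E ∧
        (∀ x : (τ.B u).toStarSubalgebra, 0 ≤ (x : H →L[ℂ] H) → E x = 0 → τ.q u * x * τ.q u = 0) ∧
        ∀ x, vecState Ω (E x) = vecState Ω (τ.q u * x * τ.q u) := by
  have main := fun (u : ℝ≥0∞) (hu : 0 < u) => τ.exists_condExp hu hsep hF
  refine ⟨⟨τ.isStrongLimit Ω, ?_⟩, fun u hu =>
    ⟨τ.isStrongLimit Ω, main u hu (τ.reducedA u) (τ.mem_reducedA_iff u)⟩⟩
  -- As q_∞ = 1, the condition q_u z = z is vacuous, and the target is all of A_τ.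
  obtain ⟨E, h1, h2, h3, h4, h5⟩ := main ⊤ ENNReal.zero_lt_top (asAlg (τ.A ⊤)) (fun z => by
    rw [τ.top, one_mul]
    exact (and_iff_left rfl).symm)
  refine ⟨E, h1, h2, h3, fun x hx h0 => Subtype.ext ?_, fun x => ?_⟩
  · simpa [τ.top] using h4 x hx h0
  · simpa [τ.top] using h5 x
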